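/- Conventions. For a commutative ring $B$, the real spectrum $\mathrm{Spec}_r B$ is the set of pairs $\alpha=(\mathfrak q,\le_\alpha)$, where $\mathfrak q$ is a prime ideal of $B$ and $\le_\alpha$ is an ordering of $B/\mathfrak q$; an element $b\in B$ is called positive on $\mathrm{Spec}_r B$ if its class satisfies $b\ge_\alpha 0$ for every $\alpha\in\mathrm{Spec}_r B$ (this is vacuous if $\mathrm{Spec}_r B=\emptyset$). A prime ideal $\mathfrak q$ of $B$ is real if $-1$ is not a sum of squares in $B/\mathfrak q$. A symmetric matrix $M$ over $B$ is positive semidefinite on $\mathrm{Spec}_r B$ if for every ring homomorphism $\varphi:B\to R$ into a real closed field $R$ the matrix $\varphi(M)$ is positive semidefinite. For a square matrix $M$, $\mathfrak d_k(M)$ denotes the ideal generated by the $k\times k$ minors of $M$. A Dedekind domain $A$ satisfies (PNRI) if, for every $f\in A$ such that no minimal prime ideal over $(f)$ is real, $f$ is associated in $A$ to an element that is positive on $\mathrm{Spec}_r A$. Theorem. Let $A$ be a Dedekind domain (fields allowed) satisfying (PNRI), and let $M\in A^{n\times n}$ be a symmetric matrix that is positive semidefinite on $\mathrm{Spec}_r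 A$. Suppose that for every $k=1,\dots,n$ the ideal $\mathfrak d_k(M)$ is principal, $\mathfrak d_k(M)=(d_k)$ with $d_k\in A$. Then for every prime ideal $\mathfrak p$ of $A$ and every $k=1,\dots,n$, the element $d_k$ is associated in the localization $A_{\mathfrak p}$ to an element $d'_k\in A_{\mathfrak p}$ that is positive on $\mathrm{Spec}_r A_{\mathfrak p}$ and is the image of an element of $A$ that is positive on $\mathrm{Spec}_r A$. -/

import Mathlib

universe u

/-- The real spectrum of a commutative ring `A`. A pair `(𝔭, ≤)` consisting of a prime ideal and
an ordering of `A ⧸ 𝔭` is recorded as the set of elements of `A` whose class is nonnegative; its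
support is `𝔭`. -/
abbrev RealSpectrum (A : Type u) [CommRing A] : Type u :=
  {P : RingPreordering A // P.IsOrdering}

/-- `a ≥ 0` at every point of the real spectrum of `A`. -/
def NonnegOnRealSpectrum {A : Type u} [CommRing A] (a : A) : Prop :=
  ∀ α : RealSpectrum A, a ∈ α.1

/-- `φ(M)` is positive semidefinite for every morphism `φ` from `A` to a real closed field.
(Fields in the universe of `A` suffice: they include the real closures of the ordered residue
fields of `A`.) -/
def PsdOnRealSpectrum {A : Type u} [CommRing A] {n : ℕ} (M : Matrix (Fin n) (Fin n) A) : Prop :=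
  ∀ (R : Type u) [Field R] [LinearOrder R] [IsStrictOrderedRing R] [IsRealClosed R]
    (φ : A →+* R) (x : Fin n → R), 0 ≤ x ⬝ᵥ (M.map φ).mulVec x

/-- An ideal is real prime if it is prime and `-1` is not a sum of squares in the quotient. -/
def IsRealPrime {A : Type u} [CommRing A] (𝔭 : Ideal A) : Prop :=
  𝔭.IsPrime ∧ IsSemireal (A ⧸ 𝔭)

/-- The condition (PNRI) for Dedekind domains: if no minimal prime of the principal ideal `(f)`
is real, then `f` is associated to an element that is positive on the real spectrum. -/
def PNRI (A : Type u) [CommRing A] : Prop :=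
  ∀ f : A, (∀ 𝔮 ∈ (Ideal.span {f}).minimalPrimes, ¬ IsRealPrime 𝔮) →
    ∃ g : A, Associated f g ∧ NonnegOnRealSpectrum g

/-- The ideal generated by the minors of order `k` of `M`. -/
def minorIdeal {A : Type u} [CommRing A] {n : ℕ} (M : Matrix (Fin n) (Fin n) A) (k : ℕ) :
    Ideal A :=
  Ideal.span {a | ∃ r c : Fin k ↪o Fin n, a = (M.submatrix r c).det}

/-! ### Sums of squares in rings and real fields. -/

section SumsOfSquares

/-! Zero `d k` and the zero prime are trivial; otherwise `A_𝔭` is a discrete valuation ring and `d k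
= u * ϖ ^ e`. If `A ⧸ 𝔭` is not real, some uniformizer `f` is the image of a positive element of
`A`, and `f ^ e` works (`exists_nonneg_irreducible_of_not_isSemireal`).

If `A ⧸ 𝔭` is real, then `e` is even and `d k` is associated to a square (`even_of_minorIdeal_eq`).
Indeed, by Cauchy–Binet the compound of a positive semidefinite matrix is positive semidefinite on
pairs of index sets (`Matrix.minors_nonneg_of_psd`). Since 2 is a unit, a minor of valuation `e`
yields an element of valuation `e` that is nonnegative in every real closed field. By Artin's
theorem (`exists_realClosed_neg_of_not_isSumSq`) it is a sum of squares in the fraction field, and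
there such valuations are even, because leading residues cannot cancel in a real residue field. -/

theorem IsSumSq.map_ringHom {R S : Type*} [CommRing R] [CommRing S] (f : R →+* S) {s : R}
    (hs : IsSumSq s) : IsSumSq (f s) := by
  induction hs with
  | zero => simp
  | sq_add a _ ih => simpa using ih.sq_add (f a)

theorem IsSemireal.of_ringHom {R S : Type*} [CommRing R] [CommRing S] (f : R →+* S)
    [IsSemireal S] : IsSemireal R where
  one_add_ne_zero hs h :=
    IsSemireal.one_add_ne_zero (hs.map_ringHom f) (by simpa using congrArg f h)

theorem IsSumSq.div {F : Type*} [Field F] {s t : F} (hs : IsSumSq s) (ht : IsSumSq t) :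
    IsSumSq (s / t) := by
  rcases eq_or_ne t 0 with rfl | h
  · simp
  · have : s / t = s * t * (t⁻¹ * t⁻¹) := by field_simp
    exact this ▸ (hs.mul ht).mul (.mul_self _)

theorem IsSumSq.eq_zero_of_add_eq_zero {F : Type*} [Field F] [IsSemireal F] {s t : F}
    (hs : IsSumSq s) (ht : IsSumSq t) (h : s + t = 0) : s = 0 := by
  by_contra h0
  refine IsSemireal.one_add_ne_zero (ht.div hs) ?_
  field_simp
  simpa using h

/-- Sums of squares lift along surjective ring homomorphisms. -/
theorem IsSumSq.exists_of_surjective {R S : Type*} [CommRing R] [CommRing S] {f : R →+* S}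
    (hf : Function.Surjective f) {s : S} (hs : IsSumSq s) : ∃ t, IsSumSq t ∧ f t = s := by
  induction hs with
  | zero => exact ⟨0, .zero, map_zero f⟩
  | sq_add a _ ih =>
    obtain ⟨t, ht, rfl⟩ := ih
    obtain ⟨b, rfl⟩ := hf a
    exact ⟨b * b + t, ht.sq_add b, by simp⟩

end SumsOfSquares

/-! ### Adjoining a square root to a real field. -/

section QuadraticExtension

open IntermediateField

variable {F E : Type*} [Field F] [Field E] [Algebra F E] {x : F} {r : E}

theorem isIntegral_of_mul_self_eq (hr : r * r = algebraMap F E x) : IsIntegral F r := by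
  refine ⟨Polynomial.X ^ 2 - Polynomial.C x, Polynomial.monic_X_pow_sub_C _ two_ne_zero, ?_⟩
  simp [pow_two, hr]

theorem exists_eq_add_mul_of_mem_adjoin_sqrt (hr : r * r = algebraMap F E x) {y : E}
    (hy : y ∈ F⟮r⟯) : ∃ b c : F, y = algebraMap F E b + algebraMap F E c * r := by
  have hy' : y ∈ Algebra.adjoin F {r} := by
    rw [← adjoin_simple_toSubalgebra_of_isAlgebraic (isIntegral_of_mul_self_eq hr).isAlgebraic]
    exact hy
  induction hy' using Algebra.adjoin_induction with
  | mem z hz => exact ⟨0, 1, by simp [Set.mem_singleton_iff.mp hz]⟩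
  | algebraMap b => exact ⟨b, 0, by simp⟩
  | add z w hz hw ihz ihw =>
    obtain ⟨b, c, h⟩ := ihz (algebra_adjoin_le_adjoin F _ hz)
    obtain ⟨b', c', h'⟩ := ihw (algebra_adjoin_le_adjoin F _ hw)
    exact ⟨b + b', c + c', by rw [h, h', map_add, map_add]; ring⟩
  | mul z w hz hw ihz ihw =>
    obtain ⟨b, c, h⟩ := ihz (algebra_adjoin_le_adjoin F _ hz)
    obtain ⟨b', c', h'⟩ := ihw (algebra_adjoin_le_adjoin F _ hw)
    refine ⟨b * b' + c * c' * x, b * c' + c * b', ?_⟩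
    rw [h, h']
    simp only [map_add, map_mul]
    linear_combination algebraMap F E c * algebraMap F E c' * hr

/-- Expand `(b + e r)² = (b² + x e²) + 2 b e r` and add up. -/
theorem IsSumSq.exists_of_adjoin_sqrt (hr : r * r = algebraMap F E x) {y : F⟮r⟯}
    (hy : IsSumSq y) : ∃ s t c : F, IsSumSq s ∧ IsSumSq t ∧
      (y : E) = algebraMap F E (s + x * t) + algebraMap F E c * r := by
  induction hy with
  | zero => exact ⟨0, 0, 0, .zero, .zero, by simp⟩
  | sq_add a _ ih =>
    obtain ⟨s, t, c, hs, ht, h⟩ := ih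
    obtain ⟨b, e, ha⟩ := exists_eq_add_mul_of_mem_adjoin_sqrt hr a.2
    refine ⟨b * b + s, e * e + t, 2 * b * e + c, hs.sq_add b, ht.sq_add e, ?_⟩
    push_cast
    rw [h, ha]
    simp only [map_add, map_mul, map_ofNat]
    linear_combination algebraMap F E e * algebraMap F E e * hr

/-- If adjoining a square root of a nonsquare `x` destroys reality, then `-x` is a sum of
squares. -/
theorem isSumSq_neg_of_not_isSemireal_adjoin_sqrt [IsSemireal F]
    (hr : r * r = algebraMap F E x) (hx : ¬ IsSquare x) (h : ¬ IsSemireal F⟮r⟯) :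
    IsSumSq (-x) := by
  rw [isSemireal_iff_not_isSumSq_neg_one, not_not] at h
  obtain ⟨s, t, c, hs, ht, hst⟩ := h.exists_of_adjoin_sqrt hr
  rw [show ((-1 : F⟮r⟯) : E) = -1 by simp] at hst
  -- Otherwise `r` would lie in `F` and `x` would be a square.
  have hc : c = 0 := by
    by_contra hc
    have hc' : algebraMap F E c ≠ 0 := by simpa using hc
    have hr' : r = algebraMap F E (-(1 + (s + x * t)) / c) := by
      rw [map_div₀, eq_div_iff hc', map_neg, map_add _ 1, map_one]
      linear_combination -hst
    refine hx ⟨-(1 + (s + x * t)) / c, (algebraMap F E).injective ?_⟩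
    rw [map_mul, ← hr', hr]
  have h1 : 1 + s = -x * t := (algebraMap F E).injective <| by
    simp only [hc, map_add, map_mul, map_neg, map_one, map_zero] at hst ⊢
    linear_combination -hst
  have ht0 : t ≠ 0 := fun h0 => IsSemireal.one_add_ne_zero hs (by simpa [h0] using h1)
  rw [eq_div_of_mul_eq ht0 h1.symm]
  exact (IsSumSq.one.add hs).div ht

end QuadraticExtension

/-! ### Odd degree extensions of real fields (Springer's descent). -/

section OddDegree

open Polynomial IntermediateField

variable {F : Type*} [Field F] [IsSemireal F]

/-- Leading coefficients of squares cannot cancel over a real field. -/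
theorem IsSumSq.polynomial_leadingCoeff {s : F[X]} (hs : IsSumSq s) :
    Even s.natDegree ∧ IsSumSq s.leadingCoeff := by
  induction hs with
  | zero => simp
  | @sq_add a s _ ih =>
    rcases eq_or_ne a 0 with rfl | ha
    · simpa using ih
    rcases eq_or_ne s 0 with rfl | hs
    · simp [natDegree_mul ha ha]
    have hd : (a * a).natDegree = a.natDegree + a.natDegree := natDegree_mul ha ha
    rcases lt_trichotomy (a * a).natDegree s.natDegree with h | h | h
    · rw [natDegree_add_eq_right_of_natDegree_lt h,
        leadingCoeff_add_of_degree_lt (degree_lt_degree h)]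
      exact ih
    · have hne : (a * a).leadingCoeff + s.leadingCoeff ≠ 0 := by
        rw [leadingCoeff_mul]
        intro h0
        have := IsSumSq.eq_zero_of_add_eq_zero (.mul_self a.leadingCoeff) ih.2 h0
        simp [ha] at this
      have hdeg : (a * a).degree = s.degree := by
        rw [degree_eq_natDegree (mul_ne_zero ha ha), degree_eq_natDegree hs, h]
      have h2 := leadingCoeff_add_of_degree_eq hdeg hne
      have h3 : (a * a + s).natDegree = s.natDegree := by
        refine le_antisymm ((natDegree_add_le _ _).trans (by simp [h])) ?_
        refine le_natDegree_of_ne_zero ?_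
        rw [coeff_add]
        rw [leadingCoeff, leadingCoeff, h] at hne
        exact hne
      rw [h2, h3, leadingCoeff_mul]
      exact ⟨ih.1, ih.2.sq_add _⟩
    · rw [natDegree_add_eq_left_of_natDegree_lt h,
        leadingCoeff_add_of_degree_lt' (degree_lt_degree h), leadingCoeff_mul, hd]
      exact ⟨⟨_, rfl⟩, .mul_self _⟩

theorem IsSumSq.exists_polynomial_reduced {F : Type*} [Field F] {p : F[X]} (hp : p.natDegree ≠ 0) {s : F[X]}
    (hs : IsSumSq s) :
    ∃ t : F[X], IsSumSq t ∧ p ∣ s - t ∧ t.natDegree + 2 ≤ 2 * p.natDegree := by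
  induction hs with
  | zero => exact ⟨0, .zero, by simp, by simp; lia⟩
  | sq_add a _ ih =>
    obtain ⟨t, ht, ⟨q, hq⟩, hd⟩ := ih
    have hlt := natDegree_mod_lt a hp
    refine ⟨(a % p) * (a % p) + t, ht.sq_add _, ⟨(a / p) * (a + a % p) + q, ?_⟩, ?_⟩
    · have := EuclideanDomain.div_add_mod a p
      linear_combination hq - (a + a % p) * this
    · have h1 := natDegree_add_le ((a % p) * (a % p)) t
      have h2 := natDegree_mul_le (p := a % p) (q := a % p)
      rcases le_max_iff.mp h1 with h | h <;> lia

/-- Reducing the squares mod `p` gives `1 + t = p * h` of even degree at most `2 deg p - 2`. So `h`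
has odd degree smaller than `deg p` and again divides `1 + t`: descent. -/
theorem not_dvd_one_add_isSumSq_of_odd_natDegree (p : F[X]) (hp : Odd p.natDegree) (s : F[X])
    (hs : IsSumSq s) : ¬ p ∣ 1 + s := by
  induction hn : p.natDegree using Nat.strong_induction_on generalizing p s with
  | _ n ih =>
    intro hps
    subst hn
    obtain ⟨t, ht, hst, hd⟩ := hs.exists_polynomial_reduced hp.pos.ne'
    obtain ⟨h, hh⟩ : p ∣ 1 + t := by
      have := dvd_sub hps hst
      rwa [show 1 + s - (s - t) = 1 + t by ring] at this
    have ht1 : IsSumSq (1 + t) := IsSumSq.one.add ht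
    have hne : 1 + t ≠ 0 := by
      intro h0
      have hev := congrArg (eval 0) h0
      simp only [eval_add, eval_one, eval_zero] at hev
      exact IsSemireal.one_add_ne_zero (ht.map_ringHom (evalRingHom 0)) hev
    have hp0 : p ≠ 0 := by rintro rfl; simp at hp
    have hh0 : h ≠ 0 := by rintro rfl; simp at hh; exact hne hh
    have hev := ht1.polynomial_leadingCoeff.1
    have hle := natDegree_add_le (1 : F[X]) t
    simp only [natDegree_one, Nat.zero_le, sup_of_le_right] at hle
    have hdeg : (1 + t).natDegree = p.natDegree + h.natDegree := by
      rw [hh, natDegree_mul hp0 hh0]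
    have hodd : Odd h.natDegree := by
      rw [hdeg] at hev
      rcases Nat.even_or_odd h.natDegree with he | ho
      · exact absurd hev (Nat.not_even_iff_odd.mpr (hp.add_even he))
      · exact ho
    exact ih h.natDegree (by lia) h hodd t ht rfl ⟨p, by rw [hh, mul_comm]⟩

/-- A simple extension of odd degree of a real field is real. -/
theorem isSemireal_adjoin_of_odd_natDegree_minpoly {E : Type*} [Field E] [Algebra F E] {θ : E}
    (hθ : IsIntegral F θ) (hodd : Odd (minpoly F θ).natDegree) : IsSemireal F⟮θ⟯ := by
  rw [isSemireal_iff_not_isSumSq_neg_one]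
  intro h
  let g : F[X] →ₐ[F] F⟮θ⟯ := aeval (AdjoinSimple.gen F θ)
  have hg : Function.Surjective g := by
    intro y
    have hy : (y : E) ∈ Algebra.adjoin F {θ} := by
      rw [← adjoin_simple_toSubalgebra_of_isAlgebraic hθ.isAlgebraic]
      exact y.2
    obtain ⟨q, hq⟩ := Algebra.adjoin_singleton_eq_range_aeval F θ ▸ hy
    refine ⟨q, Subtype.ext ?_⟩
    have : ((F⟮θ⟯.val) (aeval (AdjoinSimple.gen F θ) q)) = aeval θ q := by
      rw [← Polynomial.aeval_algHom_apply]; simp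
    exact this.trans hq
  obtain ⟨s, hs, hsg⟩ := h.exists_of_surjective (f := g.toRingHom) hg
  refine not_dvd_one_add_isSumSq_of_odd_natDegree _ hodd s hs ?_
  apply minpoly.dvd
  have : aeval (AdjoinSimple.gen F θ) (1 + s) = 0 := by
    rw [map_add, map_one]
    change 1 + g.toRingHom s = 0
    rw [hsg]; ring
  have h2 := congrArg F⟮θ⟯.val this
  rw [← Polynomial.aeval_algHom_apply] at h2
  simpa using h2

end OddDegree

/-! ### Maximal real subfields and Artin's theorem. -/

section MaximalSemireal

open Polynomial IntermediateField

variable {Ω : Type u} [Field Ω]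

theorem exists_maximal_isSemireal_subfield (L₀ : Subfield Ω) (h₀ : IsSemireal L₀) :
    ∃ L : Subfield Ω, L₀ ≤ L ∧ Maximal (fun L : Subfield Ω => IsSemireal L) L := by
  refine zorn_le_nonempty₀ {L : Subfield Ω | IsSemireal L} ?_ L₀ h₀
  intro C hC hchain y hy
  have hne : C.Nonempty := ⟨y, hy⟩
  have hdir : DirectedOn (· ≤ ·) C := hchain.directedOn
  refine ⟨sSup C, ?_, fun z hz => le_sSup hz⟩
  -- A sum of squares involves finitely many elements, so it lives in one member of the chain.
  have key : ∀ s : (sSup C : Subfield Ω), IsSumSq s →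
      ∃ L ∈ C, ∃ t : L, IsSumSq t ∧ (t : Ω) = s := by
    intro s hs
    induction hs with
    | zero => exact ⟨y, hy, 0, .zero, by simp⟩
    | sq_add a _ ih =>
      obtain ⟨L, hL, t, ht, hts⟩ := ih
      obtain ⟨L', hL', haL'⟩ := (Subfield.mem_sSup_of_directedOn hne hdir).mp a.2
      obtain ⟨L'', hL'', h1, h2⟩ := hdir L hL L' hL'
      refine ⟨L'', hL'', (⟨a, h2 haL'⟩ : L'') * ⟨a, h2 haL'⟩ + Subfield.inclusion h1 t,
        (ht.map_ringHom _).sq_add _, ?_⟩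
      rw [Subfield.coe_add, Subfield.coe_add, Subfield.coe_mul, Subfield.coe_mul, ← hts]
      rfl
  change IsSemireal (sSup C : Subfield Ω)
  refine ⟨fun {s} hs h => ?_⟩
  obtain ⟨L, hL, t, ht, hts⟩ := key s hs
  have : IsSemireal L := hC hL
  refine IsSemireal.one_add_ne_zero ht (Subtype.ext ?_)
  have := congrArg (Subtype.val) h
  simpa [hts] using this

theorem mem_of_maximal_isSemireal {L : Subfield Ω}
    (hL : Maximal (fun L : Subfield Ω => IsSemireal L) L) {r : Ω} (h : IsSemireal L⟮r⟯) :
    r ∈ L := by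
  have hle : L ≤ L⟮r⟯.toSubfield := fun y hy => L⟮r⟯.algebraMap_mem ⟨y, hy⟩
  exact hL.2 (y := L⟮r⟯.toSubfield) h hle (mem_adjoin_simple_self L r)

variable [IsAlgClosed Ω]

/-- A maximal real subfield of an algebraically closed field is real closed. -/
theorem isRealClosed_of_maximal_isSemireal {L : Subfield Ω}
    (hL : Maximal (fun L : Subfield Ω => IsSemireal L) L) : IsRealClosed L := by
  have : IsSemireal L := hL.1
  have hsq : ∀ x : L, ¬ IsSquare x → IsSumSq (-x) := by
    intro x hx
    obtain ⟨r, hr⟩ := IsAlgClosed.exists_eq_mul_self (x : Ω)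
    refine isSumSq_neg_of_not_isSemireal_adjoin_sqrt (E := Ω) (r := r) hr.symm hx fun h => ?_
    exact hx ⟨⟨r, mem_of_maximal_isSemireal hL h⟩, Subtype.ext hr⟩
  refine { one_add_ne_zero := IsSemireal.one_add_ne_zero, isSquare_or_isSquare_neg := ?_,
           exists_isRoot_of_odd_natDegree := ?_ }
  · intro x
    by_contra! h
    have h1 := hsq x h.1
    have h2 := hsq (-x) h.2
    rw [neg_neg] at h2
    refine h.1 ?_
    rw [IsSumSq.eq_zero_of_add_eq_zero h2 h1 (by ring)]
    exact IsSquare.zero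
  · intro f hf
    induction hn : f.natDegree using Nat.strong_induction_on generalizing f with
    | _ n ih =>
      subst hn
      have hf0 : f ≠ 0 := by rintro rfl; simp at hf
      obtain ⟨θ, hθ⟩ := IsAlgClosed.exists_aeval_eq_zero Ω f
        (fun h => absurd hf (by rw [natDegree_eq_zero_iff_degree_le_zero.mpr h.le]; decide))
      have hint : IsIntegral L θ := IsAlgebraic.isIntegral ⟨f, hf0, hθ⟩
      obtain ⟨g, hg⟩ := minpoly.dvd L θ hθ
      have hg0 : g ≠ 0 := by rintro rfl; simp at hg; exact hf0 hg
      have hdeg : f.natDegree = (minpoly L θ).natDegree + g.natDegree := by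
        conv_lhs => rw [hg, natDegree_mul (minpoly.ne_zero hint) hg0]
      -- If the minimal polynomial has odd degree, `L(θ)` is real and maximality puts `θ` in `L`; if
      -- even, the cofactor `g` has smaller odd degree.
      rcases Nat.even_or_odd (minpoly L θ).natDegree with he | ho
      · have hodd : Odd g.natDegree := by
          rw [hdeg] at hf
          rcases Nat.even_or_odd g.natDegree with h | h
          · exact absurd (he.add h) (Nat.not_even_iff_odd.mpr hf)
          · exact h
        have hpos := minpoly.natDegree_pos hint
        obtain ⟨y, hy⟩ := ih g.natDegree (by lia) hodd rfl
        refine ⟨y, ?_⟩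
        rw [hg]
        exact hy.dvd (dvd_mul_left _ _)
      · have hmem := mem_of_maximal_isSemireal hL
          (isSemireal_adjoin_of_odd_natDegree_minpoly hint ho)
        refine ⟨⟨θ, hmem⟩, ?_⟩
        have : (algebraMap L Ω) (eval ⟨θ, hmem⟩ f) = 0 := by
          rw [← aeval_algebraMap_apply_eq_algebraMap_eval]
          exact hθ
        exact (algebraMap L Ω).injective (by simpa using this)

end MaximalSemireal

/-- The squares of a real closed field are the positive cone of a field ordering. -/
theorem IsRealClosed.exists_linearOrder (R : Type u) [Field R] [IsRealClosed R] :
    ∃ _ : LinearOrder R, IsStrictOrderedRing R := by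
  classical
  let C : RingCone R :=
    { Subsemiring.sumSq R with
      eq_zero_of_mem_of_neg_mem' := by
        intro a ha hna
        have ha' : a ∈ Subsemiring.sumSq R := ha
        have hna' : -a ∈ Subsemiring.sumSq R := hna
        rw [Subsemiring.mem_sumSq] at ha' hna'
        exact IsSumSq.eq_zero_of_add_eq_zero ha' hna' (by ring) }
  have hC : ∀ a : R, IsSquare a → a ∈ C := fun a ha => by
    have : a ∈ Subsemiring.sumSq R := by simpa using ha.isSumSq
    exact this
  have : HasMemOrNegMem C :=
    ⟨fun a => (IsRealClosed.isSquare_or_isSquare_neg a).imp (hC _) (hC _)⟩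
  let : LinearOrder R := LinearOrder.mkOfAddGroupCone C
  have : IsOrderedRing R := IsOrderedRing.mkOfCone C
  exact ⟨inferInstance, IsOrderedRing.toIsStrictOrderedRing R⟩

/-- If `-1` is a sum of squares in a field of characteristic not two, every element is. -/
theorem isSemireal_of_not_isSumSq {K : Type*} [Field K] (h2 : (2 : K) ≠ 0) {a : K}
    (ha : ¬ IsSumSq a) : IsSemireal K := by
  rw [isSemireal_iff_not_isSumSq_neg_one]
  intro h
  have h1 : a = (a + 1) / 2 * ((a + 1) / 2) + -1 * ((a - 1) / 2 * ((a - 1) / 2)) := by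
    field_simp
    ring
  exact ha (h1 ▸ (IsSumSq.mul_self _).add (h.mul (.mul_self _)))

/-- An element of a field of characteristic not two that is not a sum of squares is negative under some embedding
into a real closed field. -/
theorem exists_realClosed_neg_of_not_isSumSq {K : Type u} [Field K] (h2 : (2 : K) ≠ 0) {a : K}
    (ha : ¬ IsSumSq a) :
    ∃ (R : Type u) (_ : Field R) (_ : LinearOrder R) (_ : IsStrictOrderedRing R)
      (_ : IsRealClosed R) (φ : K →+* R), φ a < 0 := by
  have := isSemireal_of_not_isSumSq h2 ha
  let Ω := AlgebraicClosure K
  -- `K(√-a)` is still real, since otherwise `a` would be a sum of squares. In a real closed field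
  -- containing it, `-a` is a square.
  obtain ⟨r, hr⟩ := IsAlgClosed.exists_eq_mul_self (algebraMap K Ω (-a))
  have hsemi : IsSemireal (IntermediateField.adjoin K {r}) := by
    by_contra h
    by_cases hsq : IsSquare (-a)
    · obtain ⟨b, hb⟩ := hsq
      have hrb : r ∈ (⊥ : IntermediateField K Ω) := by
        rw [hb, map_mul] at hr
        rcases mul_self_eq_mul_self_iff.mp hr with h | h
        · exact IntermediateField.mem_bot.mpr ⟨b, h⟩
        · exact IntermediateField.mem_bot.mpr ⟨-b, by rw [map_neg, h, neg_neg]⟩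
      rw [IntermediateField.adjoin_simple_eq_bot_iff.mpr hrb] at h
      exact h (IsSemireal.of_ringHom (IntermediateField.botEquiv K Ω).toRingEquiv.toRingHom)
    · exact ha (by simpa using isSumSq_neg_of_not_isSemireal_adjoin_sqrt hr.symm hsq h)
  obtain ⟨L, hle, hL⟩ := exists_maximal_isSemireal_subfield
    (IntermediateField.adjoin K {r}).toSubfield hsemi
  have := isRealClosed_of_maximal_isSemireal hL
  obtain ⟨_, _⟩ := IsRealClosed.exists_linearOrder L
  have hK : ∀ x : K, algebraMap K Ω x ∈ L := fun x =>
    hle ((IntermediateField.adjoin K {r}).algebraMap_mem x)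
  refine ⟨L, inferInstance, ‹_›, ‹_›, this, (algebraMap K Ω).codRestrict L hK, ?_⟩
  have hrL : r ∈ L := hle (IntermediateField.mem_adjoin_simple_self K r)
  have heq : (algebraMap K Ω).codRestrict L hK a = -((⟨r, hrL⟩ : L) * ⟨r, hrL⟩) := by
    apply Subtype.ext
    have : algebraMap K Ω a = -(r * r) := by rw [← hr, map_neg, neg_neg]
    exact this
  have ha0 : (algebraMap K Ω).codRestrict L hK a ≠ 0 := by
    rw [map_ne_zero]
    rintro rfl
    exact ha .zero
  refine lt_of_le_of_ne ?_ ha0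
  rw [heq]
  exact neg_nonpos.mpr (mul_self_nonneg _)

/-! ### Parity of valuations over a real residue field. -/

section DiscreteValuationRing

open IsLocalRing IsDiscreteValuationRing

variable {B : Type u} [CommRing B] [IsDomain B] [IsDiscreteValuationRing B]

theorem IsLocalRing.isUnit_two_of_isSemireal_residueField (B : Type*) [CommRing B]
    [IsLocalRing B] [IsSemireal (ResidueField B)] : IsUnit (2 : B) := by
  rw [← residue_ne_zero_iff_isUnit, map_ofNat]
  exact two_ne_zero

/-- Over a discrete valuation ring with real residue field, the valuation of a sum of squares is
even, and the leading residue is a sum of squares. -/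
theorem IsSumSq.eq_zero_or_eq_mul_pow_even [IsSemireal (ResidueField B)] {ϖ : B}
    (hϖ : Irreducible ϖ) {s : B} (hs : IsSumSq s) :
    s = 0 ∨ ∃ (m : ℕ) (u : B), IsSumSq (residue B u) ∧ residue B u ≠ 0 ∧
      s = u * ϖ ^ (2 * m) := by
  have hres : residue B ϖ = 0 := (residue_eq_zero_iff ϖ).mpr hϖ.not_isUnit
  induction hs with
  | zero => exact .inl rfl
  | @sq_add a s _ ih =>
    rcases eq_or_ne a 0 with rfl | ha
    · simpa using ih
    obtain ⟨l, w, rfl⟩ := eq_unit_mul_pow_irreducible ha hϖ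
    have hw : residue B w ≠ 0 := (residue_ne_zero_iff_isUnit _).mpr w.isUnit
    right
    rcases ih with rfl | ⟨m, u, hu, hu0, rfl⟩
    · exact ⟨l, w * w, by simp, by simp [hw], by ring⟩
    · rcases lt_trichotomy l m with h | rfl | h
      · obtain ⟨j, rfl⟩ := Nat.exists_eq_add_of_lt h
        refine ⟨l, w * w + u * ϖ ^ (2 * j + 2), ?_, ?_, by ring⟩
        · simp [hres]
        · simp [hres, hw]
      · refine ⟨l, w * w + u, by simpa using hu.sq_add _, ?_, by ring⟩
        intro h0
        rw [map_add, map_mul] at h0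
        have := IsSumSq.eq_zero_of_add_eq_zero (.mul_self _) hu h0
        simp [hw] at this
      · obtain ⟨j, rfl⟩ := Nat.exists_eq_add_of_lt h
        refine ⟨m, w * w * ϖ ^ (2 * j + 2) + u, ?_, ?_, by ring⟩
        · simpa [hres] using hu
        · simpa [hres] using hu0

/-- Denominators are cleared by a square, which preserves the parity of valuations. -/
theorem IsSumSq.exists_mul_self_mul_eq_algebraMap {B K : Type*} [CommRing B] [IsDomain B]
    [Field K] [Algebra B K] [IsFractionRing B K] {x : K} (hx : IsSumSq x) :
    ∃ c s : B, c ≠ 0 ∧ IsSumSq s ∧ algebraMap B K (c * c) * x = algebraMap B K s := by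
  induction hx with
  | zero => exact ⟨1, 0, one_ne_zero, .zero, by simp⟩
  | sq_add a _ ih =>
    obtain ⟨c, s, hc, hs, h⟩ := ih
    obtain ⟨p, q, hq, rfl⟩ := IsFractionRing.div_surjective (A := B) a
    have hq0 : q ≠ 0 := nonZeroDivisors.ne_zero hq
    have hq' : algebraMap B K q ≠ 0 := by simpa using hq0
    refine ⟨c * q, (c * p) * (c * p) + q * q * s, mul_ne_zero hc hq0,
      ((IsSumSq.mul_self q).mul hs).sq_add _, ?_⟩
    simp only [map_add, map_mul] at h ⊢
    field_simp
    linear_combination algebraMap B K q ^ 2 * h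

theorem not_isSumSq_algebraMap_of_odd [IsSemireal (ResidueField B)] {ϖ : B}
    (hϖ : Irreducible ϖ) (u : Bˣ) {e : ℕ} (he : Odd e) :
    ¬ IsSumSq (algebraMap B (FractionRing B) (u * ϖ ^ e)) := by
  intro h
  obtain ⟨c, s, hc, hs, hcs⟩ := h.exists_mul_self_mul_eq_algebraMap (B := B)
  rw [← map_mul] at hcs
  have hcs := IsFractionRing.injective B (FractionRing B) hcs
  obtain ⟨l, w, rfl⟩ := eq_unit_mul_pow_irreducible hc hϖ
  rcases hs.eq_zero_or_eq_mul_pow_even hϖ with rfl | ⟨m, v, -, hv, rfl⟩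
  · simp [hϖ.ne_zero] at hcs
  · obtain ⟨v, rfl⟩ := (residue_ne_zero_iff_isUnit _).mp hv
    have := unit_mul_pow_congr_pow hϖ hϖ (w * w * u) v (2 * l + e) (2 * m) (by
      rw [← hcs]; push_cast; ring)
    grind

/-- An element of a discrete valuation ring with real residue field that is nonnegative under all
morphisms to real closed fields has even valuation. -/
theorem even_of_nonneg_realClosed [IsSemireal (ResidueField B)] {ϖ : B} (hϖ : Irreducible ϖ)
    (u : Bˣ) {e : ℕ}
    (h : ∀ (R : Type u) [Field R] [LinearOrder R] [IsStrictOrderedRing R] [IsRealClosed R]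
      (φ : B →+* R), 0 ≤ φ (u * ϖ ^ e)) : Even e := by
  by_contra he
  have h2 : (2 : FractionRing B) ≠ 0 := by
    have := (isUnit_two_of_isSemireal_residueField B).ne_zero
    rw [← map_ofNat (algebraMap B (FractionRing B)) 2]
    simpa using this
  obtain ⟨R, _, _, _, _, φ, hφ⟩ := exists_realClosed_neg_of_not_isSumSq h2
    (not_isSumSq_algebraMap_of_odd hϖ u (Nat.not_even_iff_odd.mp he))
  exact absurd (h R (φ.comp (algebraMap B _))) (not_le.mpr hφ)

theorem exists_eq_unit_mul_pow_of_dvd_of_not_dvd {ϖ : B} (hϖ : Irreducible ϖ) {x : B} {e : ℕ}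
    (h : ϖ ^ e ∣ x) (h' : ¬ ϖ ^ (e + 1) ∣ x) : ∃ u : Bˣ, x = u * ϖ ^ e := by
  obtain ⟨y, rfl⟩ := h
  have hy : IsUnit y := by
    by_contra hy
    have : y ∈ IsLocalRing.maximalIdeal B := hy
    rw [hϖ.maximalIdeal_eq, Ideal.mem_span_singleton] at this
    exact h' (by rw [pow_succ]; exact mul_dvd_mul_left _ this)
  obtain ⟨u, rfl⟩ := hy
  exact ⟨u, mul_comm _ _⟩

end DiscreteValuationRing

/-! ### Cauchy–Binet and compounds of semidefinite matrices. -/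

section Minors

open Matrix

variable {R : Type*} [CommRing R] {m : Type*} [Fintype m] {k : ℕ}

theorem Matrix.det_mul_eq_sum_prod_mul_det (A : Matrix (Fin k) m R) (B : Matrix m (Fin k) R) :
    (A * B).det = ∑ f : Fin k → m, (∏ i, A i (f i)) * (B.submatrix f id).det := by
  classical
  have h : (A * B : Matrix (Fin k) (Fin k) R) = fun i => ∑ j, A i j • B j := by
    ext i l
    simp [Matrix.mul_apply]
  rw [h]
  change (detRowAlternating : (Fin k → R) [⋀^Fin k]→ₗ[R] R).toMultilinearMap _ = _
  rw [MultilinearMap.map_sum]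
  refine Finset.sum_congr rfl fun f _ => ?_
  rw [MultilinearMap.map_smul_univ]
  rfl

/-- The Cauchy–Binet formula, with the sum extended over all sequences of indices. -/
theorem Matrix.factorial_mul_det_mul (A : Matrix (Fin k) m R) (B : Matrix m (Fin k) R) :
    (k.factorial : R) * (A * B).det =
      ∑ f : Fin k → m, (A.submatrix id f).det * (B.submatrix f id).det := by
  -- Permuting the rows of `A` gives a second `sign σ` that cancels the first; the `k!` permutations
  -- contribute equally.
  have key : ∀ σ : Equiv.Perm (Fin k),
      ∑ f : Fin k → m, ((Equiv.Perm.sign σ : ℤ) : R) * (∏ i, A (σ i) (f i)) *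
        (B.submatrix f id).det = (A * B).det := by
    intro σ
    have h1 := Matrix.det_mul_eq_sum_prod_mul_det (A.submatrix σ id) B
    have h2 : (A.submatrix σ id) * B = (A * B).submatrix σ id := by
      rw [← Matrix.submatrix_mul_equiv A B σ (Equiv.refl m) id]; rfl
    rw [h2, Matrix.det_permute] at h1
    simp_rw [mul_assoc, ← Finset.mul_sum]
    have h3 : ((Equiv.Perm.sign σ : ℤ) : R) * ((Equiv.Perm.sign σ : ℤ) : R) = 1 := by
      rw [← Int.cast_mul, ← Units.val_mul, Int.units_mul_self]; simp
    simp only [submatrix_apply, id_eq] at h1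
    rw [← h1, ← mul_assoc, h3, one_mul]
  simp_rw [Matrix.det_apply' (A.submatrix _ _), Finset.sum_mul]
  rw [Finset.sum_comm]
  simp only [submatrix_apply, id_eq]
  rw [Finset.sum_congr rfl fun σ _ => key σ]
  simp [Fintype.card_perm]

variable {F : Type*} [Field F] [LinearOrder F] [IsStrictOrderedRing F] {n : ℕ}

/-- A positive semidefinite symmetric matrix over an ordered field is congruent to a
nonnegative diagonal matrix. -/
theorem Matrix.exists_eq_mul_diagonal_mul_transpose {M : Matrix (Fin n) (Fin n) F}
    (hsymm : M.IsSymm) (hpsd : ∀ x : Fin n → F, 0 ≤ x ⬝ᵥ M.mulVec x) :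
    ∃ (l : ℕ) (P : Matrix (Fin n) (Fin l) F) (D : Fin l → F),
      (∀ i, 0 ≤ D i) ∧ M = P * diagonal D * Pᵀ := by
  let B : LinearMap.BilinForm F (Fin n → F) := Matrix.toBilin' M
  have hB : ∀ x y, B x y = x ⬝ᵥ M.mulVec y := fun x y => Matrix.toBilin'_apply' M x y
  have hBs : LinearMap.IsSymm B := by
    refine ⟨fun x y => ?_⟩
    rw [RingHom.id_apply, hB, hB, dotProduct_mulVec, ← mulVec_transpose, hsymm.eq,
      dotProduct_comm]
  have : Invertible (2 : F) := invertibleOfNonzero two_ne_zero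
  obtain ⟨v, hv⟩ := LinearMap.BilinForm.exists_orthogonal_basis hBs
  -- Rows of `P` are the coordinates of the standard basis in an orthogonal basis.
  refine ⟨_, Matrix.of fun i j => v.repr (Pi.single i 1) j, fun j => B (v j) (v j),
    fun j => by simpa only [hB] using hpsd _, ?_⟩
  ext i j
  have h1 : M i j = B (Pi.single i 1) (Pi.single j 1) := by
    rw [hB]; simp
  rw [h1]
  conv_lhs => rw [← v.sum_repr (Pi.single i 1), ← v.sum_repr (Pi.single j 1)]
  simp only [map_sum, LinearMap.sum_apply, map_smul, LinearMap.smul_apply, smul_eq_mul]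
  simp only [mul_apply, diagonal_apply, transpose_apply, of_apply, mul_ite, mul_zero,
    Finset.sum_ite_eq', Finset.mem_univ, if_true]
  refine Finset.sum_congr rfl fun a _ => ?_
  rw [Finset.sum_eq_single a]
  · ring
  · intro b _ hba
    have : B (v b) (v a) = 0 := hv hba
    simp [this]
  · simp

/-- The quadratic form of the compound matrix of a positive semidefinite matrix is nonnegative
at the vectors supported on at most two index sets. -/
theorem Matrix.minors_nonneg_of_psd {M : Matrix (Fin n) (Fin n) F}
    (hsymm : M.IsSymm) (hpsd : ∀ x : Fin n → F, 0 ≤ x ⬝ᵥ M.mulVec x) (r c : Fin k → Fin n)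
    (a b : F) :
    0 ≤ a ^ 2 * (M.submatrix r r).det + b ^ 2 * (M.submatrix c c).det +
      2 * (a * b) * (M.submatrix r c).det := by
  obtain ⟨l, P, D, hD, rfl⟩ := Matrix.exists_eq_mul_diagonal_mul_transpose hsymm hpsd
  have key : ∀ r c : Fin k → Fin n, (k.factorial : F) *
      ((P * diagonal D * Pᵀ).submatrix r c).det =
      ∑ f : Fin k → Fin l, (∏ i, D (f i)) * (P.submatrix r f).det * (P.submatrix c f).det := by
    intro r c
    have h : (P * diagonal D * Pᵀ).submatrix r c =
        (P * diagonal D).submatrix r id * Pᵀ.submatrix id c := by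
      rw [← Matrix.submatrix_mul_equiv _ _ r (Equiv.refl _) c]; rfl
    rw [h, Matrix.factorial_mul_det_mul]
    refine Finset.sum_congr rfl fun f _ => ?_
    congr 1
    · rw [← Matrix.det_mul_row]
      congr 1
      ext i j
      simp [mul_comm]
    · rw [← Matrix.det_transpose]
      rfl
  have hk : (0 : F) < k.factorial := by exact_mod_cast k.factorial_pos
  refine nonneg_of_mul_nonneg_right ?_ hk
  -- By Cauchy–Binet, the form becomes a sum of squares with nonnegative weights.
  have : (k.factorial : F) * (a ^ 2 * ((P * diagonal D * Pᵀ).submatrix r r).det +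
      b ^ 2 * ((P * diagonal D * Pᵀ).submatrix c c).det +
      2 * (a * b) * ((P * diagonal D * Pᵀ).submatrix r c).det) =
      ∑ f : Fin k → Fin l, (∏ i, D (f i)) *
        (a * (P.submatrix r f).det + b * (P.submatrix c f).det) ^ 2 := by
    rw [mul_add, mul_add, mul_left_comm, mul_left_comm _ (b ^ 2), mul_left_comm _ (2 * (a * b)),
      key, key, key, Finset.mul_sum, Finset.mul_sum, Finset.mul_sum, ← Finset.sum_add_distrib,
      ← Finset.sum_add_distrib]
    exact Finset.sum_congr rfl fun f _ => by ring
  rw [this]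
  exact Finset.sum_nonneg fun f _ =>
    mul_nonneg (Finset.prod_nonneg fun i _ => hD _) (sq_nonneg _)

end Minors

/-! ### Positivity on the real spectrum. -/

section RealSpectrum

/-- Orderings pull back along `f`. -/
theorem NonnegOnRealSpectrum.map {A B : Type u} [CommRing A] [CommRing B] (f : A →+* B) {a : A}
    (ha : NonnegOnRealSpectrum a) : NonnegOnRealSpectrum (f a) := by
  rintro ⟨P, hP⟩
  let Q : RingPreordering A :=
    { P.toSubsemiring.comap f with
      mem_of_isSquare' := fun {x} hx => P.mem_of_isSquare (hx.map f)
      neg_one_notMem' := fun h => P.neg_one_notMem (by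
        have : f (-1) ∈ P := h
        simpa using this) }
  have hQ : Q.IsOrdering := by
    rw [RingPreordering.isOrdering_iff] at hP ⊢
    intro x y hxy
    have : f (-(x * y)) ∈ P := hxy
    rw [map_neg, map_mul] at this
    exact hP _ _ this
  exact ha ⟨Q, hQ⟩

theorem nonnegOnRealSpectrum_of_isSumSq {A : Type u} [CommRing A] {a : A} (ha : IsSumSq a) :
    NonnegOnRealSpectrum a :=
  fun _ => RingPreordering.mem_of_isSumSq ha

theorem NonnegOnRealSpectrum.pow {A : Type u} [CommRing A] {a : A} (ha : NonnegOnRealSpectrum a)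
    (e : ℕ) : NonnegOnRealSpectrum (a ^ e) :=
  fun α => pow_mem (ha α) e

/-- An element is nonnegative as soon as four times it is a sum of squares. -/
theorem nonnegOnRealSpectrum_of_isSumSq_four_mul {A : Type u} [CommRing A] {a : A}
    (ha : IsSumSq (4 * a)) : NonnegOnRealSpectrum a := by
  rintro ⟨P, hP⟩
  rcases mem_or_neg_mem P a with h | h
  · exact h
  · have h4 : 4 * a ∈ P := RingPreordering.mem_of_isSumSq ha
    have := add_mem (add_mem h4 h) (add_mem h h)
    rwa [show 4 * a + -a + (-a + -a) = a by ring] at this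

end RealSpectrum

/-! ### Even valuation of determinantal ideals. -/

section LocalParity

open IsLocalRing IsDiscreteValuationRing

variable {A B : Type u} [CommRing A] [CommRing B] [IsDomain B] [IsDiscreteValuationRing B]

/-- If a determinantal ideal of a positive semidefinite matrix becomes principal in a discrete
valuation ring with real residue field, then its valuation there is even. -/
theorem even_of_minorIdeal_eq [Algebra A B] [IsSemireal (ResidueField B)] {n : ℕ}
    {M : Matrix (Fin n) (Fin n) A} (hsymm : M.IsSymm) (hpsd : PsdOnRealSpectrum M) {k : ℕ} {d : A}
    (hd : minorIdeal M k = Ideal.span {d}) {ϖ : B} (hϖ : Irreducible ϖ) {e : ℕ} (u : Bˣ)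
    (hde : algebraMap A B d = u * ϖ ^ e) : Even e := by
  have hnonneg : ∀ (r c : Fin k ↪o Fin n) (a b : ℕ) (R : Type u) [Field R] [LinearOrder R]
      [IsStrictOrderedRing R] [IsRealClosed R] (φ : B →+* R),
      0 ≤ φ ((a : B) ^ 2 * algebraMap A B (M.submatrix r r).det +
        (b : B) ^ 2 * algebraMap A B (M.submatrix c c).det +
        2 * (a * b : B) * algebraMap A B (M.submatrix r c).det) := by
    intro r c a b R _ _ _ _ φ
    have := Matrix.minors_nonneg_of_psd (M := M.map (φ.comp (algebraMap A B)))
      (hsymm.map _) (hpsd R (φ.comp (algebraMap A B))) r c a b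
    have hdet : ∀ r c : Fin k → Fin n, φ (algebraMap A B (M.submatrix r c).det) =
        ((M.map (φ.comp (algebraMap A B))).submatrix r c).det := fun r c => by
      rw [← RingHom.comp_apply, RingHom.map_det]
      rfl
    simpa only [map_add, map_mul, map_pow, map_natCast, map_ofNat, hdet] using this
  have hdvd : ∀ r c : Fin k ↪o Fin n, ϖ ^ e ∣ algebraMap A B (M.submatrix r c).det := by
    intro r c
    have hmem : (M.submatrix r c).det ∈ minorIdeal M k := Ideal.subset_span ⟨r, c, rfl⟩
    rw [hd, Ideal.mem_span_singleton] at hmem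
    have := map_dvd (algebraMap A B) hmem
    rw [hde] at this
    exact (dvd_mul_left _ _).trans this
  obtain ⟨r, c, hrc⟩ : ∃ r c : Fin k ↪o Fin n,
      ¬ ϖ ^ (e + 1) ∣ algebraMap A B (M.submatrix r c).det := by
    by_contra! hall
    have hle : minorIdeal M k ≤ (Ideal.span {ϖ ^ (e + 1)}).comap (algebraMap A B) := by
      refine Ideal.span_le.mpr ?_
      rintro _ ⟨r, c, rfl⟩
      exact Ideal.mem_span_singleton.mpr (hall r c)
    have hmem : d ∈ minorIdeal M k := hd ▸ Ideal.mem_span_singleton_self d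
    have h1 : ϖ ^ (e + 1) ∣ algebraMap A B d := Ideal.mem_span_singleton.mp (hle hmem)
    rw [hde, Units.dvd_mul_left, pow_dvd_pow_iff hϖ.ne_zero hϖ.not_isUnit] at h1
    lia
  have hdiag : ∀ r : Fin k ↪o Fin n,
      ¬ ϖ ^ (e + 1) ∣ algebraMap A B (M.submatrix r r).det → Even e := by
    intro r hr
    obtain ⟨v, hv⟩ := exists_eq_unit_mul_pow_of_dvd_of_not_dvd hϖ (hdvd r r) hr
    refine even_of_nonneg_realClosed hϖ v ?_
    intro R _ _ _ _ φ
    simpa [← hv] using hnonneg r r 1 0 R φ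
  by_cases hr : ϖ ^ (e + 1) ∣ algebraMap A B (M.submatrix r r).det
  · by_cases hc : ϖ ^ (e + 1) ∣ algebraMap A B (M.submatrix c c).det
    -- Both principal minors have higher valuation and 2 is a unit, so the form at `(1, 1)` has the
    -- exact valuation `e` of the mixed minor.
    · have hne : ¬ ϖ ^ (e + 1) ∣ algebraMap A B (M.submatrix r r).det +
          algebraMap A B (M.submatrix c c).det + 2 * algebraMap A B (M.submatrix r c).det := by
        rw [dvd_add_right (dvd_add hr hc),
          (isUnit_two_of_isSemireal_residueField B).dvd_mul_left]
        exact hrc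
      obtain ⟨v, hv⟩ := exists_eq_unit_mul_pow_of_dvd_of_not_dvd hϖ
        (dvd_add (dvd_add (hdvd r r) (hdvd c c)) ((hdvd r c).mul_left 2)) hne
      refine even_of_nonneg_realClosed hϖ v ?_
      intro R _ _ _ _ φ
      rw [← hv]
      simpa using hnonneg r c 1 1 R φ
    · exact hdiag c hc
  · exact hdiag r hr

end LocalParity

/-! ### Uniformizers at a prime. -/

section Localization

open IsLocalRing

variable {A : Type u} [CommRing A] (𝔭 : Ideal A) [𝔭.IsPrime]

theorem exists_irreducible_algebraMap_atPrime [IsDomain A]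
    [IsDiscreteValuationRing (Localization.AtPrime 𝔭)] :
    ∃ x : A, Irreducible (algebraMap A (Localization.AtPrime 𝔭) x) := by
  obtain ⟨ϖ, hϖ⟩ := IsDiscreteValuationRing.exists_irreducible (Localization.AtPrime 𝔭)
  obtain ⟨⟨x, s⟩, hxs⟩ := IsLocalization.surj 𝔭.primeCompl ϖ
  have hs := IsLocalization.map_units (Localization.AtPrime 𝔭) s
  refine ⟨x, ?_⟩
  change ϖ * algebraMap A _ s = algebraMap A _ x at hxs
  rw [← hxs]
  exact (irreducible_mul_isUnit hs).mpr hϖ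

theorem isSemireal_residueField_atPrime [𝔭.IsMaximal] [IsSemireal (A ⧸ 𝔭)] :
    IsSemireal (ResidueField (Localization.AtPrime 𝔭)) :=
  IsSemireal.of_ringHom
    (IsLocalization.AtPrime.equivQuotMaximalIdeal 𝔭 (Localization.AtPrime 𝔭)).symm.toRingHom

/-- At a nonreal prime there is a uniformizer that is nonnegative on the real spectrum. -/
theorem exists_nonneg_irreducible_of_not_isSemireal [IsDomain A]
    [IsDiscreteValuationRing (Localization.AtPrime 𝔭)] (h : ¬ IsSemireal (A ⧸ 𝔭)) :
    ∃ f : A, NonnegOnRealSpectrum f ∧ Irreducible (algebraMap A (Localization.AtPrime 𝔭) f) := by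
  obtain ⟨x, hx⟩ := exists_irreducible_algebraMap_atPrime 𝔭
  rw [isSemireal_iff_not_isSumSq_neg_one, not_not] at h
  obtain ⟨t, ht, htq⟩ := h.exists_of_surjective (f := Ideal.Quotient.mk 𝔭)
    Ideal.Quotient.mk_surjective
  have ht𝔭 : 1 + t ∈ 𝔭 := by
    rw [← Ideal.Quotient.eq_zero_iff_mem, map_add, htq, map_one]
    ring
  -- As `1 + t ∈ 𝔭`, the correction term has valuation at least 2, so a uniformizer remains one. As
  -- `t ≥ 0`, the sum is at least `x + x² + 1 > 0`.
  refine ⟨x + (1 + t) ^ 2 * (x ^ 2 + 1), nonnegOnRealSpectrum_of_isSumSq_four_mul ?_, ?_⟩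
  · have h4 : 4 * (x + (1 + t) ^ 2 * (x ^ 2 + 1)) =
        (2 * x + 1) * (2 * x + 1) + ((3 : ℕ) +
          (4 : ℕ) * ((2 : ℕ) * t + t * t) * (x * x + 1)) := by
      push_cast
      ring
    rw [h4]
    have hn : ∀ m : ℕ, IsSumSq (m : A) := fun m => IsSumSq.natCast m
    exact IsSumSq.sq_add _ ((hn 3).add (((hn 4).mul (((hn 2).mul ht).add (ht.mul ht))).mul
      (IsSumSq.one.sq_add x)))
  · have hmem : algebraMap A (Localization.AtPrime 𝔭) (1 + t) ∈
        maximalIdeal (Localization.AtPrime 𝔭) :=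
      (IsLocalization.AtPrime.to_map_mem_maximal_iff _ 𝔭 _).mpr ht𝔭
    rw [hx.maximalIdeal_eq, Ideal.mem_span_singleton] at hmem
    obtain ⟨y, hy⟩ := hmem
    rw [map_add, map_mul, map_pow, hy]
    set p := algebraMap A (Localization.AtPrime 𝔭) x
    set q := algebraMap A (Localization.AtPrime 𝔭) (x ^ 2 + 1)
    rw [show p + (p * y) ^ 2 * q = p * (1 + p * (y ^ 2 * q)) by ring]
    refine (irreducible_mul_isUnit ?_).mpr hx
    by_contra hu
    have h1 : 1 + p * (y ^ 2 * q) ∈ maximalIdeal (Localization.AtPrime 𝔭) := hu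
    have h2 : p * (y ^ 2 * q) ∈ maximalIdeal (Localization.AtPrime 𝔭) :=
      Ideal.mul_mem_right _ _ hx.not_isUnit
    exact (Ideal.ne_top_iff_one _).mp (maximalIdeal.isMaximal _).ne_top
      ((Ideal.add_mem_iff_left _ h2).mp h1)

end Localization

/-! ### The cases at `𝔭`. -/

theorem mainTheorem3 {A : Type*} [CommRing A] [IsDedekindDomain A] (hA : PNRI A)
    {n : ℕ} (M : Matrix (Fin n) (Fin n) A) (hsymm : M.IsSymm) (hpsd : PsdOnRealSpectrum M)
    (d : ℕ → A) (hd : ∀ k : ℕ, 1 ≤ k → k ≤ n → minorIdeal M k = Ideal.span {d k})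
    (𝔭 : Ideal A) [𝔭.IsPrime] (k : ℕ) (hk : 1 ≤ k) (hkn : k ≤ n) :
    ∃ d' : Localization.AtPrime 𝔭,
      Associated (algebraMap A (Localization.AtPrime 𝔭) (d k)) d' ∧
      NonnegOnRealSpectrum d' ∧
      ∃ a : A, algebraMap A (Localization.AtPrime 𝔭) a = d' ∧ NonnegOnRealSpectrum a := by
  suffices h : ∃ a : A, NonnegOnRealSpectrum a ∧
      Associated (algebraMap A (Localization.AtPrime 𝔭) (d k))
        (algebraMap A (Localization.AtPrime 𝔭) a) by
    obtain ⟨a, ha, hda⟩ := h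
    exact ⟨_, hda, ha.map _, a, rfl, ha⟩
  rcases eq_or_ne (d k) 0 with h0 | h0
  · exact ⟨0, nonnegOnRealSpectrum_of_isSumSq .zero, by rw [h0]⟩
  rcases eq_or_ne 𝔭 ⊥ with hbot | hbot
  · refine ⟨1, nonnegOnRealSpectrum_of_isSumSq .one, ?_⟩
    rw [map_one, associated_one_iff_isUnit]
    exact IsLocalization.map_units (M := 𝔭.primeCompl) (Localization.AtPrime 𝔭)
      ⟨d k, fun h => h0 (by simpa [hbot] using h)⟩
  have : IsDiscreteValuationRing (Localization.AtPrime 𝔭) :=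
    IsLocalization.AtPrime.isDiscreteValuationRing_of_dedekind_domain A hbot _
  have : 𝔭.IsMaximal := Ideal.IsPrime.isMaximal ‹_› hbot
  have hd0 : algebraMap A (Localization.AtPrime 𝔭) (d k) ≠ 0 := by
    rwa [Ne, IsLocalization.to_map_eq_zero_iff _ 𝔭.primeCompl_le_nonZeroDivisors]
  by_cases hreal : IsSemireal (A ⧸ 𝔭)
  · obtain ⟨x, hx⟩ := exists_irreducible_algebraMap_atPrime 𝔭
    obtain ⟨e, u, hu⟩ := IsDiscreteValuationRing.eq_unit_mul_pow_irreducible hd0 hx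
    have := isSemireal_residueField_atPrime 𝔭
    obtain ⟨m, rfl⟩ := even_of_minorIdeal_eq hsymm hpsd (hd k hk hkn) hx u hu
    refine ⟨x ^ (m + m), nonnegOnRealSpectrum_of_isSumSq ?_, ?_⟩
    · rw [pow_add]
      exact .mul_self _
    · rw [hu, map_pow]
      exact associated_unit_mul_left _ _ u.isUnit
  · obtain ⟨f, hf, hirr⟩ := exists_nonneg_irreducible_of_not_isSemireal 𝔭 hreal
    obtain ⟨e, u, hu⟩ := IsDiscreteValuationRing.eq_unit_mul_pow_irreducible hd0 hirr
    refine ⟨f ^ e, hf.pow e, ?_⟩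
    rw [hu, map_pow]
    exact associated_unit_mul_left _ _ u.isUnit
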